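/- Let $D$ be a division ring which is finite-dimensional over its center. A valuation on $D$ is a surjective homomorphism $v\colon D^\times\to\Gamma_v$ onto a totally ordered group $\Gamma_v$ (written additively, not assumed commutative) such that $v(a+b)\ge\min\{v(a),v(b)\}$ whenever $a,b\in D^\times$ and $a+b\ne 0$; it is nontrivial if $\Gamma_v\neq\{0\}$. Two valuations $v,v'$ are regarded as equal if $v'=\sigma\circ v$ for some isomorphism $\sigma\colon\Gamma_v\to\Gamma_{v'}$ of totally ordered groups, and as distinct otherwise. The height of $v$ is the supremum of all integers $r\ge 0$ for which there is a chain $\Gamma_v=\Gamma_0\to\Gamma_1\to\cdots\to\Gamma_r=\{0\}$ of epimorphisms of totally ordered groups all having nontrivial kernels. The $v$-adic topology on $D$ is the one in which the sets $\{x\}\cup\{x+y : y\in D^\times,\ v(y)>\delta\}$, $\delta\in\Gamma_v$, $\delta\ge 0$, form a fundamental system of neighborhoods of each $x\in D$; $D^\times$ carries the induced topology, and a subgroup of $D^\times$ is called $v$-adically open if it is open in it. Let $r\ge 2$, let $w_1,\dots,w_r$ be (pairwise) distinct valuations of height $1$ on $D$, and let $N_1,\dots,N_r$ be proper subgroups of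 $D^\times$ such that $N_i$ is $w_i$-adically open for $i=1,\dots,r$. Let $N=N_1\cap\cdots\cap N_r$. Then $N$ is not $u$-adically open for any nontrivial valuation $u$ on $D$. -/

import Mathlib

universe u v

/-- `HasEpiChain r Γ`: there is a chain `Γ = Γ₀ → Γ₁ → ⋯ → Γ_r = {0}` of epimorphisms of totally
ordered groups (surjective monotone homomorphisms), all with nontrivial kernels. -/
def HasEpiChain : ℕ → ∀ (Γ : Type v) [AddGroup Γ] [LinearOrder Γ], Prop
  | 0, Γ, _, _ => Subsingleton Γ
  | r + 1, Γ, _, _ =>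
      ∃ (Γ' : Type v) (_ : AddGroup Γ') (_ : LinearOrder Γ') (_ : AddLeftMono Γ')
        (_ : AddRightMono Γ') (μ : Γ →+ Γ'),
        Function.Surjective μ ∧ Monotone μ ∧ μ.ker ≠ ⊥ ∧ HasEpiChain r Γ'

/-- The height (rank) of a totally ordered group: the supremum of the lengths of chains of
epimorphisms with nontrivial kernels ending in the trivial group. -/
noncomputable def ordHeight (Γ : Type v) [AddGroup Γ] [LinearOrder Γ] : ℕ∞ :=
  ⨆ (r : ℕ) (_ : HasEpiChain r Γ), (r : ℕ∞)

/-- A valuation on a division ring `D`: a surjective homomorphism from `Dˣ` onto a (not necessarily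
commutative) totally ordered group `Γ`, written additively, such that
`v (a + b) ≥ min (v a) (v b)` whenever `a + b ≠ 0`. -/
structure DivValuation (D : Type u) [DivisionRing D] (Γ : Type v) [AddGroup Γ] [LinearOrder Γ]
    [AddLeftMono Γ] [AddRightMono Γ] where
  toFun : Dˣ → Γ
  map_mul : ∀ a b : Dˣ, toFun (a * b) = toFun a + toFun b
  surjective : Function.Surjective toFun
  min_le_map_add : ∀ a b c : Dˣ, (c : D) = (a : D) + (b : D) →
    min (toFun a) (toFun b) ≤ toFun c

namespace DivValuation

variable {D : Type u} [DivisionRing D] {Γ : Type v} [AddGroup Γ] [LinearOrder Γ]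
  [AddLeftMono Γ] [AddRightMono Γ]

/-- The valuation is not the trivial one. -/
def IsNontrivial (w : DivValuation D Γ) : Prop := ∃ x : Dˣ, w.toFun x ≠ 0

/-- The height of a valuation is the height of its value group. -/
noncomputable def height (_w : DivValuation D Γ) : ℕ∞ := ordHeight Γ

/-- Two valuations are identified when they differ by an isomorphism of totally ordered
value groups. -/
def IsEquiv {Γ' : Type*} [AddGroup Γ'] [LinearOrder Γ'] [AddLeftMono Γ'] [AddRightMono Γ']
    (w : DivValuation D Γ) (w' : DivValuation D Γ') : Prop :=
  ∃ e : Γ ≃+o Γ', ∀ x : Dˣ, w'.toFun x = e (w.toFun x)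

/-- `𝔪(δ) = {x ∈ Dˣ : w x > δ} ∪ {0}`. -/
def idealGT (w : DivValuation D Γ) (δ : Γ) : Set D :=
  {x | x = 0 ∨ ∃ a : Dˣ, (a : D) = x ∧ δ < w.toFun a}

theorem idealGT_anti (w : DivValuation D Γ) {δ ε : Γ} (h : δ ≤ ε) :
    w.idealGT ε ⊆ w.idealGT δ := by
  rintro x (hx | ⟨a, ha, hlt⟩)
  · exact Or.inl hx
  · exact Or.inr ⟨a, ha, lt_of_le_of_lt h hlt⟩

/-- The `w`-adic topology on `D`: the sets `x + 𝔪(δ)`, `δ ≥ 0`, form a fundamental system of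
neighbourhoods of `x`. -/
@[reducible] def adicTopology (w : DivValuation D Γ) : TopologicalSpace D where
  IsOpen U := ∀ x ∈ U, ∃ δ : Γ, 0 ≤ δ ∧ ∀ y ∈ w.idealGT δ, x + y ∈ U
  isOpen_univ := fun _ _ => ⟨0, le_refl 0, fun _ _ => trivial⟩
  isOpen_inter := by
    intro U V hU hV x hx
    obtain ⟨δ, hδ, h1⟩ := hU x hx.1
    obtain ⟨ε, _, h2⟩ := hV x hx.2
    exact ⟨max δ ε, le_trans hδ (le_max_left _ _), fun y hy =>
      ⟨h1 y (w.idealGT_anti (le_max_left _ _) hy), h2 y (w.idealGT_anti (le_max_right _ _) hy)⟩⟩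
  isOpen_sUnion := by
    intro S hS x hx
    obtain ⟨U, hU, hxU⟩ := hx
    obtain ⟨δ, hδ, h⟩ := hS U hU x hxU
    exact ⟨δ, hδ, fun y hy => ⟨U, hU, h y hy⟩⟩

/-- The `w`-adic topology on `Dˣ`, induced from the `w`-adic topology on `D`. -/
@[reducible] def unitsAdicTopology (w : DivValuation D Γ) : TopologicalSpace Dˣ :=
  TopologicalSpace.induced (fun a : Dˣ => (a : D)) w.adicTopology

/-- A subgroup of `Dˣ` is `w`-adically open if it is open in the `w`-adic topology of `Dˣ`. -/
def IsAdicOpen (w : DivValuation D Γ) (N : Subgroup Dˣ) : Prop :=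
  w.unitsAdicTopology.IsOpen (N : Set Dˣ)

end DivValuation

/-!
If a subgroup `N ⊆ N₁ ∩ N₂` is open for a nontrivial valuation `u`, then each proper subgroup `Nᵢ`
is open for both `wᵢ` and `u`. For independent valuations this is impossible: by weak approximation
every unit is a product of a unit close to `1` for one of them and a unit close to `1` for the
other. Since `wᵢ` has height one and `D` is algebraic over its center, the value group of `wᵢ` is
archimedean, and then the only alternative to independence is that `wᵢ` is a coarsening of `u`.
Finally, two coarsenings of the same valuation are never independent, so by the same alternative
`w₁` and `w₂` are coarsenings of each other, that is, they are equal.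
-/

section OrderedGroup

variable {Γ : Type v} [AddGroup Γ] [LinearOrder Γ]

theorem HasEpiChain.le_ordHeight {r : ℕ} (h : HasEpiChain r Γ) : (r : ℕ∞) ≤ ordHeight Γ :=
  le_iSup₂ (f := fun (r : ℕ) (_ : HasEpiChain r Γ) => (r : ℕ∞)) r h

theorem nontrivial_of_ordHeight_ne_zero (h : ordHeight Γ ≠ 0) : Nontrivial Γ := by
  contrapose! h
  refine nonpos_iff_eq_zero.1 (iSup₂_le fun r hr => ?_)
  cases r with
  | zero => exact le_rfl
  | succ r =>
    obtain ⟨_, _, _, _, _, μ, _, _, hker, _⟩ := hr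
    exact absurd (Subsingleton.elim _ _) hker

theorem hasEpiChain_one [Nontrivial Γ] : HasEpiChain 1 Γ := by
  refine ⟨PUnit, inferInstance, inferInstance, inferInstance, inferInstance, 0,
    fun _ => ⟨0, rfl⟩, fun _ _ _ => le_rfl, ?_, inferInstanceAs (Subsingleton PUnit)⟩
  simpa only [AddMonoidHom.ker_zero] using top_ne_bot

variable [AddLeftMono Γ]

/-- The archimedean property of a possibly noncommutative ordered group; Mathlib's `Archimedean` is
only available for commutative ones. -/
def IsArchimedeanOrder (Γ : Type*) [AddGroup Γ] [LinearOrder Γ] : Prop :=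
  ∀ ⦃g : Γ⦄, 0 < g → ∀ h : Γ, ∃ n : ℕ, h ≤ n • g

theorem IsArchimedeanOrder.exists_lt_nsmul (hΓ : IsArchimedeanOrder Γ) {g : Γ} (hg : 0 < g)
    (h : Γ) : ∃ n : ℕ, h < n • g := by
  obtain ⟨n, hn⟩ := hΓ hg h
  exact ⟨n + 1, by rw [succ_nsmul]; exact hn.trans_lt (lt_add_of_pos_right _ hg)⟩

variable [AddRightMono Γ]

/-- The linear order on the quotient of a totally ordered group by a convex normal subgroup `H`:
`p ≤ q` when `q` is obtained from `p` by adding the class of a nonnegative element. -/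
@[reducible] noncomputable def convexQuotientLinearOrder (H : AddSubgroup Γ) [H.Normal]
    [(H : Set Γ).OrdConnected] : LinearOrder (Γ ⧸ H) where
  le p q := ∃ g : Γ, 0 ≤ g ∧ q = g + p
  le_refl p := ⟨0, le_rfl, by simp⟩
  le_trans := by
    rintro p _ _ ⟨g, hg, rfl⟩ ⟨g', hg', rfl⟩
    exact ⟨g' + g, add_nonneg hg' hg, by simp [add_assoc]⟩
  le_antisymm := by
    rintro p _ ⟨g, hg, rfl⟩ ⟨g', hg', hp⟩
    have hsum : g' + g ∈ H := by
      rw [← QuotientAddGroup.eq_zero_iff, QuotientAddGroup.mk_add]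
      simpa [← add_assoc] using hp.symm
    have hgH : g ∈ H :=
      Set.OrdConnected.out ‹_› H.zero_mem hsum ⟨hg, le_add_of_nonneg_left hg'⟩
    rw [(QuotientAddGroup.eq_zero_iff g).2 hgH, zero_add]
  le_total p q := by
    induction p, q using Quotient.inductionOn₂ with
    | h a b =>
      rcases le_total a b with hab | hba
      · exact Or.inl ⟨b - a, sub_nonneg.2 hab, by simp⟩
      · exact Or.inr ⟨a - b, sub_nonneg.2 hba, by simp⟩
  toDecidableLE := Classical.decRel _

section Quotient

attribute [local instance] convexQuotientLinearOrder

variable {H : AddSubgroup Γ} [H.Normal] [(H : Set Γ).OrdConnected]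

theorem addLeftMono_convexQuotient : AddLeftMono (Γ ⧸ H) where
  elim c := by
    induction c using QuotientAddGroup.induction_on with
    | H c =>
      rintro p _ ⟨g, hg, rfl⟩
      exact ⟨c + g - c, by simpa using hg, by simp [sub_eq_add_neg, add_assoc]⟩

theorem addRightMono_convexQuotient : AddRightMono (Γ ⧸ H) where
  elim c := by
    rintro p _ ⟨g, hg, rfl⟩
    exact ⟨g, hg, add_assoc _ _ _⟩

theorem monotone_mk_convexQuotient : Monotone (QuotientAddGroup.mk' H) :=
  fun a b hab => ⟨b - a, sub_nonneg.2 hab, by simp⟩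

theorem HasEpiChain.succ_of_quotient {r : ℕ} (hbot : H ≠ ⊥) (h : HasEpiChain r (Γ ⧸ H)) :
    HasEpiChain (r + 1) Γ :=
  ⟨Γ ⧸ H, inferInstance, inferInstance, addLeftMono_convexQuotient, addRightMono_convexQuotient,
    QuotientAddGroup.mk' H, QuotientAddGroup.mk'_surjective H, monotone_mk_convexQuotient,
    by rwa [QuotientAddGroup.ker_mk'], h⟩

theorem eq_bot_or_eq_top_of_ordHeight_le_one (h : ordHeight Γ ≤ 1) : H = ⊥ ∨ H = ⊤ := by
  by_contra! hH
  have := QuotientAddGroup.nontrivial_iff.2 hH.2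
  have htwo : ((2 : ℕ) : ℕ∞) ≤ 1 :=
    (HasEpiChain.succ_of_quotient hH.1 hasEpiChain_one).le_ordHeight.trans h
  exact absurd htwo (by decide)

end Quotient

/-- The elements of an ordered group bounded in both directions by multiples of `k`. For central
`k ≥ 0` this is the smallest convex subgroup containing `k`, and it is normal. -/
def nsmulBoundedSubgroup (k : Γ) : AddSubgroup Γ where
  carrier := {x | ∃ n : ℕ, x ≤ n • k ∧ -x ≤ n • k}
  zero_mem' := ⟨0, by simp⟩
  add_mem' := by
    rintro x y ⟨m, hxm, hxm'⟩ ⟨n, hyn, hyn'⟩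
    refine ⟨m + n, ?_, ?_⟩
    · rw [add_nsmul]
      exact add_le_add hxm hyn
    · rw [neg_add_rev, add_comm m, add_nsmul]
      exact add_le_add hyn' hxm'
  neg_mem' := by
    rintro x ⟨n, hn, hn'⟩
    exact ⟨n, hn', by rwa [neg_neg]⟩

theorem self_mem_nsmulBoundedSubgroup {k : Γ} (hk : 0 ≤ k) : k ∈ nsmulBoundedSubgroup k :=
  ⟨1, by rw [one_nsmul], by simpa using (neg_nonpos.2 hk).trans hk⟩

theorem ordConnected_nsmulBoundedSubgroup {k : Γ} (hk : 0 ≤ k) :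
    (nsmulBoundedSubgroup k : Set Γ).OrdConnected := by
  refine ⟨?_⟩
  rintro x ⟨m, -, hm⟩ y ⟨n, hn, -⟩ z ⟨hxz, hzy⟩
  exact ⟨max m n, (hzy.trans hn).trans (nsmul_le_nsmul_left hk (le_max_right m n)),
    ((neg_le_neg_iff.2 hxz).trans hm).trans (nsmul_le_nsmul_left hk (le_max_left m n))⟩

theorem normal_nsmulBoundedSubgroup {k : Γ} (hk : k ∈ AddSubgroup.center Γ) :
    (nsmulBoundedSubgroup k).Normal := by
  have conj_le {n : ℕ} {x : Γ} (hx : x ≤ n • k) (y : Γ) : y + x + -y ≤ n • k :=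
    calc y + x + -y ≤ y + n • k + -y := by gcongr
      _ = n • k := by rw [AddSubgroup.mem_center_iff.1 (nsmul_mem hk n), add_neg_cancel_right]
  refine ⟨?_⟩
  rintro x ⟨n, hn, hn'⟩ y
  exact ⟨n, conj_le hn y, by simpa [add_assoc] using conj_le hn' y⟩

theorem isArchimedeanOrder_of_ordHeight_le_one
    (hcenter : ∀ g : Γ, ∃ n : ℕ, n ≠ 0 ∧ n • g ∈ AddSubgroup.center Γ) (h : ordHeight Γ ≤ 1) :
    IsArchimedeanOrder Γ := by
  intro g hg x
  obtain ⟨m, hm, hmg⟩ := hcenter g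
  have hpos : 0 < m • g := nsmul_pos hg hm
  have := normal_nsmulBoundedSubgroup hmg
  have := ordConnected_nsmulBoundedSubgroup hpos.le
  have htop : nsmulBoundedSubgroup (m • g) = ⊤ :=
    (eq_bot_or_eq_top_of_ordHeight_le_one h).resolve_left fun hbot =>
      hpos.ne' (AddSubgroup.mem_bot.1 (hbot ▸ self_mem_nsmulBoundedSubgroup hpos.le))
  obtain ⟨n, hn, -⟩ : x ∈ nsmulBoundedSubgroup (m • g) := htop ▸ AddSubgroup.mem_top x
  exact ⟨m * n, by rwa [mul_nsmul]⟩

end OrderedGroup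

namespace DivValuation

variable {D : Type*} [DivisionRing D]
  {Γ : Type*} [AddGroup Γ] [LinearOrder Γ] [AddLeftMono Γ] [AddRightMono Γ]
  {Γ' : Type*} [AddGroup Γ'] [LinearOrder Γ'] [AddLeftMono Γ'] [AddRightMono Γ']
  {Δ : Type*} [AddGroup Δ] [LinearOrder Δ] [AddLeftMono Δ] [AddRightMono Δ]

section Basic

variable (w : DivValuation D Γ)

/-- A valuation as a homomorphism of additive groups. -/
def toAddMonoidHom : Additive Dˣ →+ Γ :=
  AddMonoidHom.mk' (fun a => w.toFun a.toMul) fun a b => w.map_mul a.toMul b.toMul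

theorem map_one : w.toFun 1 = 0 := w.toAddMonoidHom.map_zero

theorem map_inv (a : Dˣ) : w.toFun a⁻¹ = -w.toFun a := w.toAddMonoidHom.map_neg (Additive.ofMul a)

theorem map_pow (a : Dˣ) (n : ℕ) : w.toFun (a ^ n) = n • w.toFun a :=
  map_nsmul w.toAddMonoidHom n (Additive.ofMul a)

theorem map_neg_one : w.toFun (-1) = 0 := by
  rw [← two_nsmul_eq_zero, ← w.map_pow, neg_one_sq, w.map_one]

theorem map_neg (a : Dˣ) : w.toFun (-a) = w.toFun a := by
  rw [← neg_one_mul, w.map_mul, w.map_neg_one, zero_add]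

theorem map_add_eq_of_lt {a b c : Dˣ} (h : (c : D) = a + b) (hlt : w.toFun a < w.toFun b) :
    w.toFun c = w.toFun a := by
  have hle : min (w.toFun c) (w.toFun b) ≤ w.toFun a := by
    simpa only [w.map_neg] using w.min_le_map_add c (-b) a (by simp [h])
  refine le_antisymm ((min_le_iff.1 hle).resolve_right hlt.not_ge) ?_
  simpa only [min_eq_left hlt.le] using w.min_le_map_add a b c h

theorem coe_mem_idealGT_iff {a : Dˣ} {δ : Γ} : (a : D) ∈ w.idealGT δ ↔ δ < w.toFun a := by
  refine ⟨?_, fun h => Or.inr ⟨a, rfl, h⟩⟩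
  rintro (h0 | ⟨b, hb, hlt⟩)
  · exact absurd h0 a.ne_zero
  · rwa [← Units.ext hb]

/-- The set `𝔪(δ)` as an additive subgroup of `D`. -/
def idealGTAddSubgroup (δ : Γ) : AddSubgroup D where
  carrier := w.idealGT δ
  zero_mem' := Or.inl rfl
  add_mem' := by
    rintro x y (rfl | ⟨a, rfl, ha⟩) hy
    · rwa [zero_add]
    rcases hy with rfl | ⟨b, rfl, hb⟩
    · rwa [add_zero, w.coe_mem_idealGT_iff]
    by_cases hab : (a : D) + b = 0
    · exact Or.inl hab
    · exact Or.inr ⟨.mk0 _ hab, rfl, (lt_min ha hb).trans_le (w.min_le_map_add a b _ rfl)⟩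
  neg_mem' := by
    rintro x (rfl | ⟨a, rfl, ha⟩)
    · exact Or.inl neg_zero
    · exact Or.inr ⟨-a, Units.val_neg a, by rwa [w.map_neg]⟩

theorem exists_forall_mul_mem_idealGT (δ : Γ) (y : D) :
    ∃ ε : Γ, ∀ x ∈ w.idealGT ε, x * y ∈ w.idealGT δ := by
  by_cases hy : y = 0
  · exact ⟨0, fun x _ => Or.inl (by rw [hy, mul_zero])⟩
  refine ⟨δ - w.toFun (.mk0 y hy), ?_⟩
  rintro x (rfl | ⟨a, rfl, ha⟩)
  · exact Or.inl (zero_mul y)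
  · exact Or.inr ⟨a * .mk0 y hy, rfl, by rwa [w.map_mul, ← sub_lt_iff_lt_add]⟩

variable {w} in
theorem IsNontrivial.exists_lt (hw : w.IsNontrivial) (δ : Γ) : ∃ a : Dˣ, δ < w.toFun a := by
  obtain ⟨x, hx⟩ := hw
  obtain ⟨d, rfl⟩ := w.surjective δ
  rcases hx.lt_or_gt with hneg | hpos
  · exact ⟨d * x⁻¹, by simpa [w.map_mul, w.map_inv] using hneg⟩
  · exact ⟨d * x, by simpa [w.map_mul] using hpos⟩

theorem isNontrivial_of_height_ne_zero (h : w.height ≠ 0) : w.IsNontrivial := by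
  have := nontrivial_of_ordHeight_ne_zero h
  obtain ⟨g, hg⟩ := exists_ne (0 : Γ)
  obtain ⟨x, rfl⟩ := w.surjective g
  exact ⟨x, hg⟩

end Basic

section Algebraic

variable (w : DivValuation D Γ)

theorem not_injective_of_sum_eq_zero {ι : Type*} [Fintype ι] [Nonempty ι] {f : ι → Dˣ}
    (hf : ∑ i, (f i : D) = 0) : ¬ Function.Injective fun i => w.toFun (f i) := by
  classical
  intro hinj
  obtain ⟨i, hmin⟩ := Finite.exists_min fun i => w.toFun (f i)
  have hrest : ∑ j ∈ {i}ᶜ, (f j : D) ∈ w.idealGTAddSubgroup (w.toFun (f i)) :=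
    sum_mem fun j hj => w.coe_mem_idealGT_iff.2 <|
      (hmin j).lt_of_ne fun h => Finset.mem_compl.1 hj (Finset.mem_singleton.2 (hinj h.symm))
  rw [Fintype.sum_eq_add_sum_compl i] at hf
  have hi : (f i : D) ∈ w.idealGT (w.toFun (f i)) := by
    rw [eq_neg_of_add_eq_zero_left hf]
    exact neg_mem hrest
  exact lt_irrefl _ (w.coe_mem_idealGT_iff.1 hi)

theorem map_mem_center {c : Dˣ} (hc : (c : D) ∈ Subring.center D) :
    w.toFun c ∈ AddSubgroup.center Γ := by
  refine AddSubgroup.mem_center_iff.2 fun g => ?_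
  obtain ⟨y, rfl⟩ := w.surjective g
  have hcomm : y * c = c * y := Units.ext (Subring.mem_center_iff.1 hc y)
  rw [← w.map_mul, ← w.map_mul, hcomm]

/-- Two terms of a polynomial equation for `x` over the center must have the same value. -/
theorem exists_map_mul_pow_eq [Algebra.IsAlgebraic (Subring.center D) D] (x : Dˣ) :
    ∃ i j : ℕ, i < j ∧ ∃ c d : Dˣ, (c : D) ∈ Subring.center D ∧ (d : D) ∈ Subring.center D ∧
      w.toFun (c * x ^ i) = w.toFun (d * x ^ j) := by
  obtain ⟨p, hp0, hp⟩ := Algebra.IsAlgebraic.isAlgebraic (R := Subring.center D) (x : D)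
  have := (Polynomial.support_nonempty.2 hp0).to_subtype
  let c (i : p.support) : Dˣ := .mk0 (p.coeff i : D) fun h =>
    Polynomial.mem_support_iff.1 i.2 (Subtype.ext h)
  have hcenter (i : p.support) : (c i : D) ∈ Subring.center D := (p.coeff i).2
  have hsum : ∑ i, ((c i * x ^ (i : ℕ) : Dˣ) : D) = 0 := by
    calc ∑ i, ((c i * x ^ (i : ℕ) : Dˣ) : D)
        = ∑ i : p.support, algebraMap (Subring.center D) D (p.coeff i) * (x : D) ^ (i : ℕ) := rfl
      _ = Polynomial.aeval (x : D) p := by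
        rw [Polynomial.aeval_def, Polynomial.eval₂_eq_sum, Polynomial.sum,
          ← Finset.sum_coe_sort p.support]
      _ = 0 := hp
  obtain ⟨i, j, heq, hij⟩ := Function.not_injective_iff.1 (w.not_injective_of_sum_eq_zero hsum)
  rcases lt_or_gt_of_ne (Subtype.coe_injective.ne hij) with hlt | hgt
  · exact ⟨i, j, hlt, c i, c j, hcenter i, hcenter j, heq⟩
  · exact ⟨j, i, hgt, c j, c i, hcenter j, hcenter i, heq.symm⟩

theorem exists_nsmul_mem_center [Algebra.IsAlgebraic (Subring.center D) D]
    (w : DivValuation D Γ) (g : Γ) : ∃ n : ℕ, n ≠ 0 ∧ n • g ∈ AddSubgroup.center Γ := by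
  obtain ⟨x, rfl⟩ := w.surjective g
  obtain ⟨i, j, hij, c, d, hc, hd, heq⟩ := w.exists_map_mul_pow_eq x
  refine ⟨j - i, Nat.sub_ne_zero_of_lt hij, ?_⟩
  have hdiff : (j - i) • w.toFun x = -w.toFun d + w.toFun c := by
    have hsplit : w.toFun (d * x ^ j) = w.toFun d + (j - i) • w.toFun x + i • w.toFun x := by
      rw [w.map_mul, w.map_pow, add_assoc, ← add_nsmul, Nat.sub_add_cancel hij.le]
    rw [w.map_mul, w.map_pow, hsplit] at heq
    rw [add_right_cancel heq, neg_add_cancel_left]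
  rw [hdiff]
  exact add_mem (neg_mem (w.map_mem_center hd)) (w.map_mem_center hc)

theorem isArchimedeanOrder_of_height_le_one [Algebra.IsAlgebraic (Subring.center D) D]
    (h : w.height ≤ 1) : IsArchimedeanOrder Γ :=
  isArchimedeanOrder_of_ordHeight_le_one w.exists_nsmul_mem_center h

end Algebraic

section WeakApproximation

/-- Independence of two valuations, in the form in which it enters weak approximation: some units
have arbitrarily large value for `u` and, at the same time, arbitrarily small value for `w`. -/
def IsIndependent (u : DivValuation D Δ) (w : DivValuation D Γ) : Prop :=
  ∀ (δ : Δ) (ε : Γ), ∃ a : Dˣ, δ < u.toFun a ∧ w.toFun a < ε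

/-- The units `c` with `c - 1 ∈ 𝔪(δ)`; for `δ ≥ 0` this is the neighbourhood `1 + 𝔪(δ)` of `1`. -/
def principalUnits (w : DivValuation D Γ) (δ : Γ) : Set Dˣ :=
  {c | (c : D) - 1 ∈ w.idealGT δ}

variable {u : DivValuation D Δ} {w : DivValuation D Γ}

theorem IsAdicOpen.exists_principalUnits_subset {N : Subgroup Dˣ} (hN : w.IsAdicOpen N) :
    ∃ δ : Γ, w.principalUnits δ ⊆ N := by
  obtain ⟨U, hU, hUN⟩ := hN
  have hone : (1 : Dˣ) ∈ (fun a : Dˣ => (a : D)) ⁻¹' U := hUN ▸ N.one_mem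
  obtain ⟨δ, -, hδ⟩ := hU _ hone
  refine ⟨δ, fun c hc => ?_⟩
  have hcU : (1 : D) + (c - 1) ∈ U := hδ _ hc
  rw [← hUN]
  simpa using hcU

namespace IsIndependent

/-- The witness is `(1 + a)⁻¹`, where `a` is large for `u` and small for `w`. -/
theorem exists_mem_idealGT_one_sub_mem_idealGT (h : u.IsIndependent w) (δ : Δ) (ε : Γ) :
    ∃ e : D, e ∈ w.idealGT ε ∧ 1 - e ∈ u.idealGT δ := by
  obtain ⟨a, hua, hwa⟩ := h (max 0 δ) (min 0 (-ε))
  obtain ⟨hua0, hδa⟩ := max_lt_iff.1 hua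
  obtain ⟨hwa0, hεa⟩ := lt_min_iff.1 hwa
  have hne : 1 + (a : D) ≠ 0 := fun h0 => by
    rw [show a = -1 from Units.ext (by simpa using eq_neg_of_add_eq_zero_right h0),
      u.map_neg_one] at hua0
    exact lt_irrefl _ hua0
  let p : Dˣ := .mk0 _ hne
  have hup : u.toFun p = 0 := by
    rw [u.map_add_eq_of_lt (a := 1) (b := a) (by simp [p]) (by rwa [u.map_one]), u.map_one]
  have hwp : w.toFun p = w.toFun a :=
    w.map_add_eq_of_lt (b := 1) (by simp [p, add_comm]) (by rwa [w.map_one])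
  refine ⟨(p⁻¹ : Dˣ), w.coe_mem_idealGT_iff.2 ?_, ?_⟩
  · rw [w.map_inv, hwp]
    exact lt_neg_of_lt_neg hεa
  · have hsub : 1 - ((p⁻¹ : Dˣ) : D) = (p⁻¹ * a : Dˣ) := by
      rw [sub_eq_iff_eq_add, Units.val_mul, ← mul_add_one, add_comm (a : D)]
      exact p.inv_mul.symm
    rw [hsub, u.coe_mem_idealGT_iff, u.map_mul, u.map_inv, hup, neg_zero, zero_add]
    exact hδa

theorem exists_sub_mem_idealGT (h : u.IsIndependent w) (x y : D) (δ : Δ) (ε : Γ) :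
    ∃ z : D, z - x ∈ u.idealGT δ ∧ z - y ∈ w.idealGT ε := by
  obtain ⟨δ', hδ'⟩ := u.exists_forall_mul_mem_idealGT δ (y - x)
  obtain ⟨ε', hε'⟩ := w.exists_forall_mul_mem_idealGT ε (x - y)
  obtain ⟨e, hwe, hue⟩ := h.exists_mem_idealGT_one_sub_mem_idealGT δ' ε'
  refine ⟨e * x + (1 - e) * y, ?_, ?_⟩
  · convert hδ' _ hue using 1
    noncomm_ring
  · convert hε' _ hwe using 1
    noncomm_ring

theorem exists_mem_principalUnits_mul_inv_mem_principalUnits (h : u.IsIndependent w) (x : Dˣ)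
    (δ : Δ) (ε : Γ) : ∃ y ∈ u.principalUnits δ, y * x⁻¹ ∈ w.principalUnits ε := by
  obtain ⟨ε', hε'⟩ := w.exists_forall_mul_mem_idealGT ε (x⁻¹ : Dˣ)
  obtain ⟨y, huy, hwy⟩ := h.exists_sub_mem_idealGT 1 x (max 0 δ) ε'
  have hy : y ≠ 0 := by
    rintro rfl
    rw [zero_sub, ← Units.val_one, ← Units.val_neg, u.coe_mem_idealGT_iff, u.map_neg_one] at huy
    exact (le_max_left 0 δ).not_gt huy
  refine ⟨.mk0 y hy, u.idealGT_anti (le_max_right 0 δ) huy, ?_⟩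
  have hmem : y * (x⁻¹ : Dˣ) - 1 ∈ w.idealGT ε := by
    rw [← Units.mul_inv x, ← sub_mul]
    exact hε' _ hwy
  exact hmem

theorem eq_top_of_principalUnits_subset (h : u.IsIndependent w) {N : Subgroup Dˣ} {δ : Δ} {ε : Γ}
    (hu : u.principalUnits δ ⊆ N) (hw : w.principalUnits ε ⊆ N) : N = ⊤ := by
  refine (Subgroup.eq_top_iff' N).2 fun x => ?_
  obtain ⟨y, hy, hyx⟩ := h.exists_mem_principalUnits_mul_inv_mem_principalUnits x δ ε
  exact inv_mem_iff.1 ((N.mul_mem_cancel_left (hu hy)).1 (hw hyx))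

end IsIndependent

end WeakApproximation

section Coarsening

/-- `w` is a coarsening of `u`: the valuation ring of `w` contains that of `u`. -/
def IsCoarseningOf (w : DivValuation D Γ) (u : DivValuation D Δ) : Prop :=
  ∀ a : Dˣ, 0 ≤ u.toFun a → 0 ≤ w.toFun a

variable {u : DivValuation D Δ} {w : DivValuation D Γ} {w' : DivValuation D Γ'}

theorem isIndependent_or_isCoarseningOf (hu : u.IsNontrivial) (hΓ : IsArchimedeanOrder Γ) :
    u.IsIndependent w ∨ w.IsCoarseningOf u := by
  refine or_iff_not_imp_right.2 fun hcoarse δ ε => ?_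
  obtain ⟨a, hua, hwa⟩ : ∃ a : Dˣ, 0 ≤ u.toFun a ∧ w.toFun a < 0 := by
    simpa only [IsCoarseningOf, not_forall, not_le, exists_prop] using hcoarse
  obtain ⟨b, hb⟩ := hu.exists_lt δ
  obtain ⟨n, hn⟩ := hΓ.exists_lt_nsmul (neg_pos.2 hwa) (w.toFun b - ε)
  refine ⟨a ^ n * b, ?_, ?_⟩
  · rw [u.map_mul, u.map_pow]
    exact hb.trans_le (le_add_of_nonneg_left (nsmul_nonneg hua n))
  · rw [neg_nsmul, lt_neg_iff_add_neg', ← add_sub_assoc, sub_neg] at hn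
    rwa [w.map_mul, w.map_pow]

theorem IsCoarseningOf.not_isIndependent (h : w.IsCoarseningOf u) (h' : w'.IsCoarseningOf u) :
    ¬ w.IsIndependent w' := by
  intro hind
  obtain ⟨a, hwa, hwa'⟩ := hind 0 0
  rcases le_total 0 (u.toFun a) with hpos | hneg
  · exact (h' a hpos).not_gt hwa'
  · have hinv : 0 ≤ w.toFun a⁻¹ := h _ (by rwa [u.map_inv, neg_nonneg])
    rw [w.map_inv, neg_nonneg] at hinv
    exact hinv.not_gt hwa

theorem IsCoarseningOf.map_le_map (h : w.IsCoarseningOf u) {a b : Dˣ}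
    (hab : u.toFun a ≤ u.toFun b) : w.toFun a ≤ w.toFun b := by
  have hnonneg : 0 ≤ w.toFun (a⁻¹ * b) := h _ <| by
    rwa [u.map_mul, u.map_inv, le_neg_add_iff_add_le, add_zero]
  rwa [w.map_mul, w.map_inv, le_neg_add_iff_add_le, add_zero] at hnonneg

theorem IsCoarseningOf.exists_orderAddMonoidHom (h : w.IsCoarseningOf u) :
    ∃ φ : Δ →+o Γ, ∀ a : Dˣ, w.toFun a = φ (u.toFun a) := by
  let s := Function.surjInv u.surjective
  have hs (g : Δ) : u.toFun (s g) = g := Function.surjInv_eq u.surjective g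
  have hfac (a : Dˣ) : w.toFun (s (u.toFun a)) = w.toFun a :=
    le_antisymm (h.map_le_map (hs _).le) (h.map_le_map (hs _).ge)
  refine ⟨{ toFun := fun g => w.toFun (s g), map_zero' := ?_, map_add' := fun g g' => ?_,
            monotone' := fun g g' hg => h.map_le_map ?_ }, fun a => (hfac a).symm⟩
  · rw [← u.map_one, hfac, w.map_one]
  · rw [← w.map_mul, ← hfac (s g * s g'), u.map_mul, hs, hs]
  · rwa [hs, hs]

theorem IsCoarseningOf.isEquiv (h : w'.IsCoarseningOf w) (h' : w.IsCoarseningOf w') :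
    w.IsEquiv w' := by
  obtain ⟨φ, hφ⟩ := h.exists_orderAddMonoidHom
  obtain ⟨ψ, hψ⟩ := h'.exists_orderAddMonoidHom
  have hψφ : Function.LeftInverse ψ φ := w.surjective.forall.2 fun a => by rw [← hφ, ← hψ]
  have hφψ : Function.RightInverse ψ φ := w'.surjective.forall.2 fun a => by rw [← hψ, ← hφ]
  refine ⟨{ toFun := φ, invFun := ψ, left_inv := hψφ, right_inv := hφψ, map_add' := map_add φ,
            map_le_map_iff' := fun {g g'} => ⟨fun hg => ?_, fun hg => φ.monotone' hg⟩ }, hφ⟩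
  rw [← hψφ g, ← hψφ g']
  exact OrderHomClass.mono ψ hg

theorem isCoarseningOf_of_isAdicOpen_of_le (hu : u.IsNontrivial) (hΓ : IsArchimedeanOrder Γ)
    {M N : Subgroup Dˣ} (hM : u.IsAdicOpen M) (hMN : M ≤ N) (hN : w.IsAdicOpen N) (htop : N ≠ ⊤) :
    w.IsCoarseningOf u := by
  obtain ⟨δ, hδ⟩ := hM.exists_principalUnits_subset
  obtain ⟨ε, hε⟩ := hN.exists_principalUnits_subset
  exact (isIndependent_or_isCoarseningOf hu hΓ).resolve_left fun hind =>
    htop (hind.eq_top_of_principalUnits_subset (hδ.trans hMN) hε)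

end Coarsening

end DivValuation

open DivValuation in
theorem mainTheorem10_general {D : Type*} [DivisionRing D]
    [Algebra.IsAlgebraic (Subring.center D) D]
    {Γ₁ : Type*} [AddGroup Γ₁] [LinearOrder Γ₁] [AddLeftMono Γ₁] [AddRightMono Γ₁]
    {Γ₂ : Type*} [AddGroup Γ₂] [LinearOrder Γ₂] [AddLeftMono Γ₂] [AddRightMono Γ₂]
    {Γu : Type*} [AddGroup Γu] [LinearOrder Γu] [AddLeftMono Γu] [AddRightMono Γu]
    {w₁ : DivValuation D Γ₁} {w₂ : DivValuation D Γ₂} {u : DivValuation D Γu}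
    (hw₁ : w₁.height = 1) (hw₂ : w₂.height = 1) (hdistinct : ¬ w₁.IsEquiv w₂)
    {N N₁ N₂ : Subgroup Dˣ} (hN₁ : N₁ ≠ ⊤) (hN₂ : N₂ ≠ ⊤)
    (hopen₁ : w₁.IsAdicOpen N₁) (hopen₂ : w₂.IsAdicOpen N₂) (hle₁ : N ≤ N₁) (hle₂ : N ≤ N₂)
    (hu : u.IsNontrivial) : ¬ u.IsAdicOpen N := by
  intro hN
  have harch₁ := w₁.isArchimedeanOrder_of_height_le_one hw₁.le
  have harch₂ := w₂.isArchimedeanOrder_of_height_le_one hw₂.le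
  have hcoarse₁ := isCoarseningOf_of_isAdicOpen_of_le hu harch₁ hN hle₁ hopen₁ hN₁
  have hcoarse₂ := isCoarseningOf_of_isAdicOpen_of_le hu harch₂ hN hle₂ hopen₂ hN₂
  have hw₁' : w₁.IsNontrivial := w₁.isNontrivial_of_height_ne_zero (by simp [hw₁])
  have hw₂' : w₂.IsNontrivial := w₂.isNontrivial_of_height_ne_zero (by simp [hw₂])
  have h₂₁ : w₂.IsCoarseningOf w₁ := (isIndependent_or_isCoarseningOf hw₁' harch₂).resolve_left
    (hcoarse₁.not_isIndependent hcoarse₂)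
  have h₁₂ : w₁.IsCoarseningOf w₂ := (isIndependent_or_isCoarseningOf hw₂' harch₁).resolve_left
    (hcoarse₂.not_isIndependent hcoarse₁)
  exact hdistinct (h₂₁.isEquiv h₁₂)

theorem mainTheorem10 {D : Type*} [DivisionRing D] [FiniteDimensional (Subring.center D) D]
    (r : ℕ) (hr : 2 ≤ r)
    (Γ : Fin r → Type*) [∀ i, AddGroup (Γ i)] [∀ i, LinearOrder (Γ i)]
    [∀ i, AddLeftMono (Γ i)] [∀ i, AddRightMono (Γ i)]
    (w : ∀ i, DivValuation D (Γ i))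
    (hheight : ∀ i, (w i).height = 1)
    (hdistinct : ∀ i j, i ≠ j → ¬ (w i).IsEquiv (w j))
    (N : Fin r → Subgroup Dˣ)
    (hproper : ∀ i, N i ≠ ⊤)
    (hopen : ∀ i, (w i).IsAdicOpen (N i)) :
    ∀ (Γu : Type*) [AddGroup Γu] [LinearOrder Γu] [AddLeftMono Γu] [AddRightMono Γu]
      (u : DivValuation D Γu), u.IsNontrivial → ¬ u.IsAdicOpen (⨅ i, N i) := by
  intro Γu _ _ _ _ u hu
  let i : Fin r := ⟨0, by omega⟩
  let j : Fin r := ⟨1, by omega⟩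
  exact mainTheorem10_general (hheight i) (hheight j) (hdistinct i j (by simp [i, j]))
    (hproper i) (hproper j) (hopen i) (hopen j) (iInf_le N i) (iInf_le N j) hu
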